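/- Let $d\ge 0$ be an integer, let $P$ be a Borel probability measure on $\mathbb{R}^d$ (with the Euclidean norm $\|\cdot\|$), let $\mathbb{X}\subset\mathbb{R}^d$ be a fixed subset, and write $B(x,r)=\{y:\|y-x\|<r\}$. The volume dimension of $P$ is $$d_{\mathrm{vol}}:=\sup\Big\{\nu\ge 0:\ \limsup_{r\to 0^+}\ \sup_{x\in\mathbb{X}}\frac{P(B(x,r))}{r^{\nu}}<\infty\Big\}.$$ Suppose that $0<d_{\mathrm{vol}}<\infty$ and that $$\sup_{x\in\mathbb{X}}\ \liminf_{r\to 0^+}\frac{P(B(x,r))}{r^{d_{\mathrm{vol}}}}>0 .$$ Let $K:\mathbb{R}^d\to\mathbb{R}$ be a bounded Borel measurable function with $$\int_0^\infty t^{d_{\mathrm{vol}}-1}\sup_{\|x\|\ge t}|K(x)|\,dt<\infty\qquad\text{and}\qquad \lim_{t\to 0^+}\ \inf_{\|x\|\le t}K(x)>0 .$$ For an i.i.d. sample $X_1,\dots,X_n$ from $P$ and a bandwidth $h>0$ put $$\hat p_h(x)=\frac{1}{nh^d}\sum_{i=1}^n K\Big(\frac{x-X_i}{h}\Big),\qquad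 p_h(x)=\mathbb{E}[\hat p_h(x)] .$$ Then there is a constant $h_{P,K}>0$, depending only on $P$ and $K$ (and on $\mathbb{X}$), and for every $\delta\in(0,1)$ a constant $C_{P,K,\delta}>0$, depending only on $P$, $K$ and $\delta$ (and on $\mathbb{X}$), such that the following holds. For every sequence $(h_n)$ of positive numbers with $\lim_n n h_n^{d_{\mathrm{vol}}}=\infty$ there is an $N$ such that, for every $n\ge N$ with $h_n\le h_{P,K}$, with probability at least $1-\delta$, $$\sup_{x\in\mathbb{X}}\big|\hat p_{h_n}(x)-p_{h_n}(x)\big|\ \ge\ C_{P,K,\delta}\sqrt{\frac{1}{n h_n^{2d-d_{\mathrm{vol}}}}}\,.$$ (The probability is understood as an inner probability: the inequality holds on a measurable set of samples of probability at least $1-\delta$.) -/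

import Mathlib

open MeasureTheory Filter Topology

noncomputable section

namespace KernelDensity

/-- `limsup_{r → 0⁺} sup_{x ∈ 𝕏} P(B(x, r)) / r ^ ν`, with `B(x, r)` the open Euclidean ball,
as an element of `[0, ∞]`. -/
def upperBallRate {d : ℕ} (𝕏 : Set (EuclideanSpace ℝ (Fin d)))
    (P : Measure (EuclideanSpace ℝ (Fin d))) (ν : ℝ) : ENNReal :=
  limsup (fun r : ℝ => ⨆ x ∈ 𝕏, P (Metric.ball x r) / ENNReal.ofReal (r ^ ν)) (𝓝[>] 0)

/-- The volume dimension of `P` relative to `𝕏`: the supremum of all `ν ≥ 0` for which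
`limsup_{r → 0⁺} sup_{x ∈ 𝕏} P(B(x, r)) / r ^ ν < ∞`.
The set always contains `0`; if it is unbounded (the volume dimension is infinite), the value of
the real `sSup` is `0`, so `0 < volDim 𝕏 P` says that the supremum is finite and positive. -/
def volDim {d : ℕ} (𝕏 : Set (EuclideanSpace ℝ (Fin d)))
    (P : Measure (EuclideanSpace ℝ (Fin d))) : ℝ :=
  sSup {ν : ℝ | 0 ≤ ν ∧ upperBallRate 𝕏 P ν < ⊤}

/-- `sup_{x ∈ 𝕏} liminf_{r → 0⁺} P(B(x, r)) / r ^ d_vol > 0`. -/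
def ExactLower {d : ℕ} (𝕏 : Set (EuclideanSpace ℝ (Fin d)))
    (P : Measure (EuclideanSpace ℝ (Fin d))) : Prop :=
  0 < ⨆ x ∈ 𝕏, liminf
    (fun r : ℝ => P (Metric.ball x r) / ENNReal.ofReal (r ^ volDim 𝕏 P)) (𝓝[>] 0)

/-- The integrability condition on the kernel with exponent `k`: `K` is bounded, and either
`d_vol = 0` or `∫₀^∞ t ^ (d_vol - 1) sup_{‖x‖ ≥ t} |K x| ^ k dt < ∞`
(the integrand takes values in `[0, ∞]`). -/
def KernelIntegrable {d : ℕ} (𝕏 : Set (EuclideanSpace ℝ (Fin d)))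
    (P : Measure (EuclideanSpace ℝ (Fin d))) (K : EuclideanSpace ℝ (Fin d) → ℝ) (k : ℝ) : Prop :=
  (∃ M : ℝ, ∀ x, |K x| ≤ M) ∧
    (volDim 𝕏 P = 0 ∨
      ∫⁻ t in Set.Ioi (0 : ℝ), ENNReal.ofReal (t ^ (volDim 𝕏 P - 1)) *
        (⨆ (x : EuclideanSpace ℝ (Fin d)) (_ : t ≤ ‖x‖), ENNReal.ofReal (|K x| ^ k)) < ⊤)

/-- `lim_{t → 0⁺} inf_{‖x‖ ≤ t} K x > 0`. -/
def PositiveNearOrigin {d : ℕ} (K : EuclideanSpace ℝ (Fin d) → ℝ) : Prop :=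
  ∃ L : ℝ, 0 < L ∧
    Tendsto (fun t : ℝ => ⨅ x : Metric.closedBall (0 : EuclideanSpace ℝ (Fin d)) t,
      K (x : EuclideanSpace ℝ (Fin d))) (𝓝[>] 0) (𝓝 L)

/-- The law `P ⊗ ⋯ ⊗ P` of an i.i.d. sample `(X₁, …, Xₙ)` from `P`. -/
def sampleLaw {d : ℕ} (P : Measure (EuclideanSpace ℝ (Fin d))) (n : ℕ) :
    Measure (Fin n → EuclideanSpace ℝ (Fin d)) :=
  Measure.pi fun _ => P

/-- The kernel density estimator `p̂_h(x) = (1 / (n h ^ d)) ∑ᵢ K((x - Xᵢ) / h)`. -/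
def kde {d n : ℕ} (K : EuclideanSpace ℝ (Fin d) → ℝ) (h : ℝ)
    (X : Fin n → EuclideanSpace ℝ (Fin d)) (x : EuclideanSpace ℝ (Fin d)) : ℝ :=
  1 / ((n : ℝ) * h ^ d) * ∑ i, K (h⁻¹ • (x - X i))

/-- The point-wise expectation `p_h(x) = 𝔼[p̂_h(x)]` of the estimator
(for `n ≥ 1` it does not depend on `n`). -/
def kdeMean {d : ℕ} (P : Measure (EuclideanSpace ℝ (Fin d)))
    (K : EuclideanSpace ℝ (Fin d) → ℝ) (n : ℕ) (h : ℝ) (x : EuclideanSpace ℝ (Fin d)) : ℝ :=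
  ∫ X, kde K h X x ∂(sampleLaw P n)

/-- `sup_{x ∈ 𝕏} |p̂_h(x) - p_h(x)|`, as an element of `[0, ∞]`. -/
def supDeviation {d n : ℕ} (𝕏 : Set (EuclideanSpace ℝ (Fin d)))
    (P : Measure (EuclideanSpace ℝ (Fin d))) (K : EuclideanSpace ℝ (Fin d) → ℝ) (h : ℝ)
    (X : Fin n → EuclideanSpace ℝ (Fin d)) : ENNReal :=
  ⨆ x ∈ 𝕏, ENNReal.ofReal |kde K h X x - kdeMean P K n h x|

end KernelDensity

end

/-!
By the exact lower rate, some `x ∈ 𝕏` has `P (ball x r) ≳ r ^ ν`, where `ν = d_vol`. The kernel is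
bounded below by a `κ > 0` on `ball x (τ * h)` after rescaling, and at most `κ / 2` away from a
slightly larger ball; since `d_vol > 0`, `x` is not an atom, so the latter happens with probability
bounded below. Hence the variance of `K ((x - Xᵢ) / h)` is `≳ h ^ ν`.

A sum `S` of independent variables bounded by `M` cannot concentrate in an interval shorter than
its standard deviation: for `|u| ≤ π / (2 * M)` its characteristic function is at most
`exp (-c * u ^ 2 * Var S)`, and integrating this Gaussian bound in an inequality of Esseen's type
gives `P (|S - b| ≤ l) ≲ l / √(Var S)` for every centre `b` and every `l ≥ M`. Taking
`b = n * h ^ d * p_h x` and `l` a small multiple of `√(n * h ^ ν)`, which eventually exceeds `M`,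
already yields the deviation at the single point `x`.
-/

section CharacteristicFunction

open ProbabilityTheory RealInnerProductSpace

variable {E : Type*} [NormedAddCommGroup E] [MeasurableSpace E]

/-- The symmetrization of `μ`: the law of `X - Y` for independent `X` and `Y` of law `μ`.
Its characteristic function is real and nonnegative and squares the modulus of that of `μ`. -/
noncomputable def symmetrization (μ : Measure E) : Measure E :=
  (μ.prod μ).map fun z => z.1 - z.2

variable [SecondCountableTopology E] [BorelSpace E]

instance (μ : Measure E) [IsProbabilityMeasure μ] : IsProbabilityMeasure (symmetrization μ) :=
  Measure.isProbabilityMeasure_map (by fun_prop)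

theorem ae_norm_le_symmetrization {μ : Measure E} {r : ℝ} (hμ : ∀ᵐ x ∂μ, ‖x‖ ≤ r) :
    ∀ᵐ x ∂symmetrization μ, ‖x‖ ≤ 2 * r := by
  rw [symmetrization, ae_map_iff (by fun_prop) (measurableSet_le (by fun_prop) (by fun_prop))]
  filter_upwards [Measure.quasiMeasurePreserving_fst.ae hμ,
    Measure.quasiMeasurePreserving_snd.ae hμ] with z h₁ h₂
  linarith [norm_sub_le z.1 z.2]

theorem symmetrization_le_of_le {μ ν : Measure E} [IsProbabilityMeasure μ]
    [ν.IsAddRightInvariant] (hμν : μ ≤ ν) : symmetrization μ ≤ ν := by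
  refine Measure.le_iff.2 fun s hs => ?_
  have hs' : MeasurableSet ((fun z : E × E => z.1 - z.2) ⁻¹' s) := hs.preimage (by fun_prop)
  calc symmetrization μ s
      = ∫⁻ y, μ ((· - y) ⁻¹' s) ∂μ := by
        rw [symmetrization, Measure.map_apply (by fun_prop) hs, Measure.prod_apply_symm hs']
        rfl
    _ ≤ ∫⁻ _, ν s ∂μ := by
        refine lintegral_mono fun y => (hμν _).trans_eq ?_
        exact (measurePreserving_sub_right ν y).measure_preimage hs.nullMeasurableSet
    _ = ν s := by simp

variable [InnerProductSpace ℝ E]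

theorem integrable_uncurry_cexp_inner (μ ν : Measure E) [IsFiniteMeasure μ] [IsFiniteMeasure ν] :
    Integrable (fun z : E × E => Complex.exp (⟪z.1, z.2⟫ * Complex.I)) (μ.prod ν) := by
  refine Integrable.of_bound (C := 1) (by fun_prop) (ae_of_all _ fun z => ?_)
  rw [Complex.norm_exp_ofReal_mul_I]

theorem integral_charFun_comm (μ ν : Measure E) [IsFiniteMeasure μ] [IsFiniteMeasure ν] :
    ∫ t, charFun μ t ∂ν = ∫ x, charFun ν x ∂μ := by
  simp_rw [charFun_apply]
  rw [← integral_integral_swap (integrable_uncurry_cexp_inner μ ν)]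
  simp_rw [real_inner_comm]

theorem re_charFun (μ : Measure E) [IsFiniteMeasure μ] (t : E) :
    (charFun μ t).re = ∫ x, Real.cos ⟪x, t⟫ ∂μ := by
  have hint : Integrable (fun x => Complex.exp (⟪x, t⟫ * Complex.I)) μ :=
    Integrable.of_bound (C := 1) (by fun_prop)
      (ae_of_all _ fun x => (Complex.norm_exp_ofReal_mul_I _).le)
  rw [charFun_apply, ← RCLike.re_eq_complex_re, ← integral_re hint]
  simp only [RCLike.re_eq_complex_re, Complex.exp_ofReal_mul_I_re]

theorem charFun_symmetrization (μ : Measure E) [IsFiniteMeasure μ] (t : E) :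
    charFun (symmetrization μ) t = ‖charFun μ t‖ ^ 2 := by
  have hexp (z : E × E) : Complex.exp (⟪z.1 - z.2, t⟫ * Complex.I) =
      Complex.exp (⟪z.1, t⟫ * Complex.I) * Complex.exp (⟪z.2, -t⟫ * Complex.I) := by
    rw [← Complex.exp_add, inner_sub_left, inner_neg_right]
    push_cast
    ring_nf
  rw [symmetrization, charFun_apply, integral_map (by fun_prop) (by fun_prop)]
  simp_rw [hexp]
  rw [integral_prod_mul (fun x => Complex.exp (⟪x, t⟫ * Complex.I))
    (fun x => Complex.exp (⟪x, -t⟫ * Complex.I)), ← charFun_apply, ← charFun_apply, charFun_neg,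
    Complex.mul_conj']

theorem integrable_charFun (μ ν : Measure E) [IsFiniteMeasure μ] [IsFiniteMeasure ν] :
    Integrable (charFun μ) ν :=
  Integrable.of_bound (C := μ.real Set.univ) (by fun_prop) (ae_of_all _ norm_charFun_le)

theorem half_le_norm_charFun {μ : Measure E} [IsProbabilityMeasure μ] {r : ℝ} {t : E}
    (hμ : ∀ᵐ x ∂μ, ‖x‖ ≤ r) (hrt : r * ‖t‖ ≤ 1) : 1 / 2 ≤ ‖charFun μ t‖ := by
  calc (1 / 2 : ℝ) = ∫ _, (1 / 2 : ℝ) ∂μ := by simp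
    _ ≤ ∫ x, Real.cos ⟪x, t⟫ ∂μ := by
        refine integral_mono_ae (integrable_const _) (Integrable.of_bound (C := 1) (by fun_prop)
          (ae_of_all _ fun _ => Real.abs_cos_le_one _)) ?_
        filter_upwards [hμ] with x hx
        have hxt : ⟪x, t⟫ ^ 2 ≤ 1 := by
          rw [sq_le_one_iff_abs_le_one]
          exact (abs_real_inner_le_norm x t).trans
            ((mul_le_mul_of_nonneg_right hx (norm_nonneg t)).trans hrt)
        linarith [Real.one_sub_sq_div_two_le_cos (x := ⟪x, t⟫)]
    _ = (charFun μ t).re := (re_charFun μ t).symm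
    _ ≤ ‖charFun μ t‖ := Complex.re_le_norm _

theorem measureReal_closedBall_zero_one_le_integral_norm_charFun (μ : Measure E)
    [IsProbabilityMeasure μ] {ρ : Measure E} [IsProbabilityMeasure ρ]
    (hρ : ∀ᵐ t ∂ρ, ‖t‖ ≤ 1) :
    μ.real (Metric.closedBall 0 1) ≤ 4 * ∫ t, ‖charFun μ t‖ ∂symmetrization ρ := by
  have hint : Integrable (fun x => ‖charFun ρ x‖ ^ 2) μ := by
    simpa only [charFun_symmetrization, ← Complex.ofReal_pow, RCLike.re_to_complex,
      Complex.ofReal_re] using (integrable_charFun (symmetrization ρ) μ).re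
  -- `‖charFun ρ‖ ^ 2` majorizes a multiple of the indicator of the unit ball and is itself the
  -- characteristic function of `symmetrization ρ`, so its `μ`-integral can be moved to `charFun μ`.
  calc μ.real (Metric.closedBall 0 1)
      = ∫ x in Metric.closedBall 0 1, 1 ∂μ := by simp
    _ ≤ ∫ x in Metric.closedBall 0 1, 4 * ‖charFun ρ x‖ ^ 2 ∂μ := by
        refine setIntegral_mono_on (integrable_const _).integrableOn
          (hint.const_mul 4).integrableOn Metric.isClosed_closedBall.measurableSet fun x hx => ?_
        have := half_le_norm_charFun (t := x) hρ (by simpa using hx)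
        nlinarith
    _ ≤ ∫ x, 4 * ‖charFun ρ x‖ ^ 2 ∂μ :=
        setIntegral_le_integral (hint.const_mul 4) (ae_of_all _ fun x => by positivity)
    _ = 4 * (∫ x, charFun (symmetrization ρ) x ∂μ).re := by
        rw [integral_const_mul]
        simp_rw [charFun_symmetrization, ← Complex.ofReal_pow]
        rw [integral_complex_ofReal, Complex.ofReal_re]
    _ ≤ 4 * ∫ t, ‖charFun μ t‖ ∂symmetrization ρ := by
        rw [integral_charFun_comm]
        gcongr
        exact (Complex.re_le_norm _).trans (norm_integral_le_integral_norm _)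

end CharacteristicFunction

section Real

open ProbabilityTheory

theorem integral_sq_symmetrization {μ : Measure ℝ} [IsProbabilityMeasure μ] (hμ : MemLp id 2 μ) :
    ∫ x, x ^ 2 ∂symmetrization μ = 2 * Var[id; μ] := by
  have hint : Integrable id μ := hμ.integrable one_le_two
  have hmean : ∫ z : ℝ × ℝ, (id z.1 + (-id) z.2) ∂(μ.prod μ) = 0 := by
    rw [integral_add (hint.comp_fst μ) (hint.neg.comp_snd μ), integral_fun_fst, integral_fun_snd]
    simp only [probReal_univ, one_smul, Pi.neg_apply, integral_neg, add_neg_cancel]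
  calc ∫ x, x ^ 2 ∂symmetrization μ
      = ∫ z : ℝ × ℝ, (id z.1 + (-id) z.2) ^ 2 ∂(μ.prod μ) := by
        rw [symmetrization, integral_map (by fun_prop) (by fun_prop)]
        simp only [sub_eq_add_neg, id_eq, Pi.neg_apply]
    _ = Var[fun z : ℝ × ℝ => id z.1 + (-id) z.2; μ.prod μ] :=
        (variance_of_integral_eq_zero (by fun_prop) hmean).symm
    _ = 2 * Var[id; μ] := by rw [variance_add_prod hμ hμ.neg, variance_neg, two_mul]

theorem norm_charFun_le_exp_neg_variance {μ : Measure ℝ} [IsProbabilityMeasure μ] {M u : ℝ}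
    (hμ : ∀ᵐ x ∂μ, ‖x‖ ≤ M) (hu : |u| * M ≤ Real.pi / 2) :
    ‖charFun μ u‖ ≤ Real.exp (-(2 / Real.pi ^ 2 * Var[id; μ] * u ^ 2)) := by
  have hμ2 : MemLp id 2 μ := MemLp.of_bound aestronglyMeasurable_id M hμ
  have hsymm := ae_norm_le_symmetrization hμ
  have hint : Integrable (fun x : ℝ => x ^ 2) (symmetrization μ) :=
    (MemLp.of_bound aestronglyMeasurable_id _ hsymm).integrable_sq
  have hcos : ∀ᵐ x ∂symmetrization μ,
      Real.cos (inner ℝ x u) ≤ 1 - 2 / Real.pi ^ 2 * u ^ 2 * x ^ 2 := by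
    filter_upwards [hsymm] with x hx
    have hxu : |inner ℝ x u| ≤ Real.pi := (abs_real_inner_le_norm x u).trans (by
      rw [Real.norm_eq_abs u]
      nlinarith [mul_le_mul_of_nonneg_right hx (abs_nonneg u)])
    refine (Real.cos_le_one_sub_mul_cos_sq hxu).trans_eq ?_
    simp only [RCLike.inner_apply, conj_trivial]
    ring
  refine le_of_sq_le_sq ?_ (Real.exp_pos _).le
  calc ‖charFun μ u‖ ^ 2
      = ∫ x, Real.cos (inner ℝ x u) ∂symmetrization μ := by
        rw [← re_charFun, charFun_symmetrization, ← Complex.ofReal_pow, Complex.ofReal_re]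
    _ ≤ ∫ x, (1 - 2 / Real.pi ^ 2 * u ^ 2 * x ^ 2) ∂symmetrization μ :=
        integral_mono_ae (Integrable.of_bound (C := 1) (by fun_prop)
          (ae_of_all _ fun _ => Real.abs_cos_le_one _))
          ((integrable_const _).sub (hint.const_mul _)) hcos
    _ = -(2 * (2 / Real.pi ^ 2 * Var[id; μ] * u ^ 2)) + 1 := by
        rw [integral_sub (integrable_const _) (hint.const_mul _), integral_const_mul,
          integral_sq_symmetrization hμ2]
        simp only [integral_const, probReal_univ, smul_eq_mul]
        ring
    _ ≤ Real.exp (-(2 * (2 / Real.pi ^ 2 * Var[id; μ] * u ^ 2))) := Real.add_one_le_exp _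
    _ = Real.exp (-(2 / Real.pi ^ 2 * Var[id; μ] * u ^ 2)) ^ 2 := by
        rw [← Real.exp_nat_mul]
        push_cast
        ring_nf

theorem measureReal_closedBall_zero_one_le_of_norm_charFun_le {μ : Measure ℝ}
    [IsProbabilityMeasure μ] {a : ℝ} (ha : 0 < a)
    (hμ : ∀ t : ℝ, |t| ≤ 1 → ‖charFun μ t‖ ≤ Real.exp (-a * t ^ 2)) :
    μ.real (Metric.closedBall 0 1) ≤ 4 * √(Real.pi / a) := by
  set ρ : Measure ℝ := volume.restrict (Metric.closedBall 0 (1 / 2)) with hρ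
  have : IsProbabilityMeasure ρ := ⟨by simp [hρ]⟩
  have hsupp : ∀ᵐ t ∂ρ, ‖t‖ ≤ 1 / 2 := by
    filter_upwards [ae_restrict_mem Metric.isClosed_closedBall.measurableSet] with t ht
    simpa using ht
  have hle : symmetrization ρ ≤ volume := symmetrization_le_of_le Measure.restrict_le_self
  have hgauss := integrable_exp_neg_mul_sq ha
  calc μ.real (Metric.closedBall 0 1)
      ≤ 4 * ∫ t, ‖charFun μ t‖ ∂symmetrization ρ :=
        measureReal_closedBall_zero_one_le_integral_norm_charFun μ
          (hsupp.mono fun t ht => ht.trans (by norm_num))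
    _ ≤ 4 * ∫ t, Real.exp (-a * t ^ 2) ∂symmetrization ρ := by
        gcongr 4 * ?_
        refine integral_mono_ae (integrable_charFun μ _).norm (hgauss.mono_measure hle) ?_
        filter_upwards [ae_norm_le_symmetrization hsupp] with t ht
        exact hμ t (by simpa using ht)
    _ ≤ 4 * ∫ t, Real.exp (-a * t ^ 2) := by
        gcongr 4 * ?_
        exact integral_mono_measure hle (ae_of_all _ fun t => (Real.exp_pos _).le) hgauss
    _ = 4 * √(Real.pi / a) := by rw [integral_gaussian]

end Real

section Sum

open ProbabilityTheory

variable {Ω ι : Type*} [MeasurableSpace Ω] {P : Measure Ω}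

theorem norm_charFun_map_div_sub {S : Ω → ℝ} (hS : AEMeasurable S P) (b l t : ℝ) :
    ‖charFun (P.map fun ω => (S ω - b) / l) t‖ = ‖charFun (P.map S) (t / l)‖ := by
  have hmap : P.map (fun ω => (S ω - b) / l) = (P.map fun ω => l⁻¹ * S ω).map (· + -(b / l)) := by
    rw [AEMeasurable.map_map_of_aemeasurable (by fun_prop) (by fun_prop)]
    congr 1 with ω
    simp only [Function.comp_apply]
    ring
  rw [hmap, charFun_map_add_const, charFun_map_mul_comp hS, norm_mul,
    Complex.norm_exp_ofReal_mul_I, mul_one, inv_mul_eq_div]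

variable [Fintype ι] {X : ι → Ω → ℝ} {M : ℝ}

theorem norm_charFun_map_sum_le_exp_neg_variance (hX : ∀ i, AEMeasurable (X i) P)
    (hindep : iIndepFun X P) (hM : ∀ i, ∀ᵐ ω ∂P, |X i ω| ≤ M) {u : ℝ}
    (hu : |u| * M ≤ Real.pi / 2) :
    ‖charFun (P.map (∑ i, X i)) u‖ ≤
      Real.exp (-(2 / Real.pi ^ 2 * Var[∑ i, X i; P] * u ^ 2)) := by
  have := hindep.isProbabilityMeasure
  have hX2 (i : ι) : MemLp (X i) 2 P := MemLp.of_bound (hX i).aestronglyMeasurable M (hM i)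
  have hterm (i : ι) : ‖charFun (P.map (X i)) u‖ ≤
      Real.exp (-(2 / Real.pi ^ 2 * Var[X i; P] * u ^ 2)) := by
    have := Measure.isProbabilityMeasure_map (hX i)
    rw [← variance_id_map (hX i)]
    refine norm_charFun_le_exp_neg_variance ?_ hu
    exact (ae_map_iff (hX i) (measurableSet_le (by fun_prop) (by fun_prop))).2 (hM i)
  rw [hindep.charFun_map_sum_eq_prod hX, Finset.prod_apply, norm_prod,
    IndepFun.variance_sum (fun i _ => hX2 i) fun i _ j _ hij => hindep.indepFun hij]
  refine (Finset.prod_le_prod (fun i _ => norm_nonneg _) fun i _ => hterm i).trans_eq ?_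
  rw [← Real.exp_sum, Finset.sum_neg_distrib, Finset.mul_sum, Finset.sum_mul]

theorem measureReal_abs_sum_sub_le_le (hX : ∀ i, AEMeasurable (X i) P)
    (hindep : iIndepFun X P) (hM : ∀ i, ∀ᵐ ω ∂P, |X i ω| ≤ M) {l : ℝ} (hl : 0 < l)
    (hMl : M ≤ l) (hVar : 0 < Var[∑ i, X i; P]) (b : ℝ) :
    P.real {ω | |∑ i, X i ω - b| ≤ l} ≤
      4 * √(Real.pi ^ 3 / 2 * (l ^ 2 / Var[∑ i, X i; P])) := by
  have := hindep.isProbabilityMeasure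
  have hsum : AEMeasurable (∑ i, X i) P := Finset.aemeasurable_sum _ fun i _ => hX i
  have hY : AEMeasurable (fun ω => ((∑ i, X i) ω - b) / l) P := by fun_prop
  have := Measure.isProbabilityMeasure_map hY
  have ha : 0 < 2 / Real.pi ^ 2 * Var[∑ i, X i; P] / l ^ 2 := by positivity
  have hcf (t : ℝ) (ht : |t| ≤ 1) : ‖charFun (P.map fun ω => ((∑ i, X i) ω - b) / l) t‖ ≤
      Real.exp (-(2 / Real.pi ^ 2 * Var[∑ i, X i; P] / l ^ 2) * t ^ 2) := by
    rw [norm_charFun_map_div_sub hsum]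
    refine (norm_charFun_map_sum_le_exp_neg_variance hX hindep hM ?_).trans_eq ?_
    · rw [abs_div, abs_of_pos hl, div_mul_eq_mul_div, div_le_iff₀ hl]
      nlinarith [abs_nonneg t, Real.pi_gt_three]
    · ring_nf
  calc P.real {ω | |∑ i, X i ω - b| ≤ l}
      = (P.map fun ω => ((∑ i, X i) ω - b) / l).real (Metric.closedBall 0 1) := by
        rw [map_measureReal_apply_of_aemeasurable hY Metric.isClosed_closedBall.measurableSet]
        congr 1 with ω
        simp [abs_of_pos hl, div_le_one hl]
    _ ≤ 4 * √(Real.pi / (2 / Real.pi ^ 2 * Var[∑ i, X i; P] / l ^ 2)) :=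
        measureReal_closedBall_zero_one_le_of_norm_charFun_le ha hcf
    _ = 4 * √(Real.pi ^ 3 / 2 * (l ^ 2 / Var[∑ i, X i; P])) := by
        congr 2
        field_simp

end Sum

section IdentDistrib

open ProbabilityTheory

theorem measureReal_pi_abs_sum_sub_le_le {Ω ι : Type*} [MeasurableSpace Ω] {P : Measure Ω}
    [IsProbabilityMeasure P] [Fintype ι] [Nonempty ι] {f : Ω → ℝ} (hf : AEMeasurable f P) {M : ℝ}
    (hM : ∀ᵐ ω ∂P, |f ω| ≤ M) {l : ℝ} (hl : 0 < l) (hMl : M ≤ l) (hVar : 0 < Var[f; P]) (b : ℝ) :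
    (Measure.pi fun _ : ι => P).real {X | |∑ i, f (X i) - b| ≤ l} ≤
      4 * √(Real.pi ^ 3 / 2 * (l ^ 2 / (Fintype.card ι * Var[f; P]))) := by
  have heval (i : ι) := measurePreserving_eval (fun _ : ι => P) i
  have hVarSum : Var[∑ i, fun X : ι → Ω => f (X i); Measure.pi fun _ => P] =
      Fintype.card ι * Var[f; P] := by
    rw [variance_sum_pi fun _ => MemLp.of_bound hf.aestronglyMeasurable M hM]
    simp only [Finset.sum_const, Finset.card_univ, nsmul_eq_mul]
  have hVarSum_pos : 0 < Var[∑ i, fun X : ι → Ω => f (X i); Measure.pi fun _ => P] := by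
    rw [hVarSum]
    positivity
  rw [← hVarSum]
  exact measureReal_abs_sum_sub_le_le
    (fun i => hf.comp_quasiMeasurePreserving (heval i).quasiMeasurePreserving)
    (iIndepFun_pi fun _ => hf) (fun i => (heval i).quasiMeasurePreserving.ae hM) hl hMl
    hVarSum_pos b

end IdentDistrib

section Variance

open ProbabilityTheory

theorem sq_mul_min_le_variance {Ω : Type*} [MeasurableSpace Ω] {μ : Measure Ω} [IsFiniteMeasure μ]
    {f : Ω → ℝ} (hf : MemLp f 2 μ) {a b : ℝ} (hba : b < a) {s t : Set Ω}
    (hs : ∀ ω ∈ s, a ≤ f ω) (ht : ∀ ω ∈ t, f ω ≤ b) :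
    ((a - b) / 2) ^ 2 * min (μ.real s) (μ.real t) ≤ Var[f; μ] := by
  set m := μ[f]
  have hpos : 0 < (a - b) / 2 := by linarith
  have hsub : s ⊆ {ω | (a - b) / 2 ≤ |f ω - m|} ∨ t ⊆ {ω | (a - b) / 2 ≤ |f ω - m|} := by
    rcases le_total m ((a + b) / 2) with hm | hm
    · refine .inl fun ω hω => Set.mem_ofPred.2 (le_abs.2 (.inl ?_))
      linarith [hs ω hω]
    · refine .inr fun ω hω => Set.mem_ofPred.2 (le_abs.2 (.inr ?_))
      linarith [ht ω hω]
  have hmin : min (μ.real s) (μ.real t) ≤ μ.real {ω | (a - b) / 2 ≤ |f ω - m|} :=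
    min_le_iff.2 (hsub.imp measureReal_mono measureReal_mono)
  rw [← le_div_iff₀' (by positivity)]
  refine hmin.trans (ENNReal.toReal_le_of_le_ofReal ?_ (meas_ge_le_variance_div_sq hf hpos))
  exact div_nonneg (variance_nonneg _ _) (sq_nonneg _)

theorem tendsto_measureReal_compl_closedBall {X : Type*} [MetricSpace X] [MeasurableSpace X]
    [OpensMeasurableSpace X] (μ : Measure X) [IsProbabilityMeasure μ] (x : X) :
    Tendsto (fun r => μ.real (Metric.closedBall x r)ᶜ) (𝓝[>] 0) (𝓝 (1 - μ.real {x})) := by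
  have hcth := tendsto_measure_cthickening_of_isClosed (μ := μ)
    ⟨1, one_pos, measure_ne_top _ _⟩ (isClosed_singleton (x := x))
  have hball : Tendsto (fun r => μ.real (Metric.closedBall x r)) (𝓝[>] 0) (𝓝 (μ.real {x})) := by
    refine ((ENNReal.tendsto_toReal (measure_ne_top _ _)).comp
      (hcth.mono_left nhdsWithin_le_nhds)).congr' ?_
    filter_upwards [self_mem_nhdsWithin] with r hr
    rw [Function.comp_apply, Metric.cthickening_singleton x (le_of_lt hr), Measure.real]
  simp_rw [probReal_compl_eq_one_sub Metric.isClosed_closedBall.measurableSet]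
  exact hball.const_sub 1

variable {E : Type*} [NormedAddCommGroup E] [NormedSpace ℝ E] [MeasurableSpace E] [BorelSpace E]
  {μ : Measure E} {K : E → ℝ} {M κ : ℝ}

theorem sq_mul_min_le_variance_comp_smul_sub [IsFiniteMeasure μ] (hK : Measurable K)
    (hM : ∀ x, |K x| ≤ M) (hκ : 0 < κ) {τ T : ℝ} (hnear : ∀ x, ‖x‖ < τ → κ ≤ K x)
    (hfar : ∀ x, T < ‖x‖ → K x ≤ κ / 2) (x : E) {h : ℝ} (hh : 0 < h) :
    (κ / 4) ^ 2 *
        min (μ.real (Metric.ball x (τ * h))) (μ.real (Metric.closedBall x (T * h))ᶜ) ≤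
      Var[fun y => K (h⁻¹ • (x - y)); μ] := by
  have hnorm (y : E) : ‖h⁻¹ • (x - y)‖ = dist y x / h := by
    rw [norm_smul, norm_inv, Real.norm_of_nonneg hh.le, ← dist_eq_norm, dist_comm, div_eq_inv_mul]
  have hmem : MemLp (fun y => K (h⁻¹ • (x - y))) 2 μ :=
    MemLp.of_bound (hK.comp (by fun_prop)).aestronglyMeasurable M (ae_of_all _ fun y => hM _)
  rw [show κ / 4 = (κ - κ / 2) / 2 by ring]
  refine sq_mul_min_le_variance hmem (half_lt_self hκ) (fun y hy => hnear _ ?_)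
    fun y hy => hfar _ ?_
  · rwa [hnorm, div_lt_iff₀ hh]
  · rw [hnorm, lt_div_iff₀ hh]
    simpa using hy

theorem eventually_mul_measureReal_ball_le_variance [IsProbabilityMeasure μ]
    (hK : Measurable K) (hM : ∀ x, |K x| ≤ M) (hκ : 0 < κ) (hnear : ∀ᶠ x in 𝓝 0, κ ≤ K x)
    (hfar : Tendsto K (Bornology.cobounded E) (𝓝 0)) {x : E} (hx : μ {x} ≠ 1) :
    ∃ c > 0, ∃ τ > 0, ∀ᶠ h in 𝓝[>] 0,
      c * μ.real (Metric.ball x (τ * h)) ≤ Var[fun y => K (h⁻¹ • (x - y)); μ] := by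
  rw [← comap_norm_atTop] at hfar
  obtain ⟨τ, hτ, hnear⟩ := Metric.eventually_nhds_iff.1 hnear
  obtain ⟨T, hT, hfar⟩ := ((atTop_basis_Ioi' 0).comap norm).eventually_iff.1
    (hfar.eventually_le_const (half_pos hκ))
  have hscale : Tendsto (T * ·) (𝓝[>] 0) (𝓝[>] 0) :=
    tendsto_iff_comap.2 (comap_mulLeft_nhdsGT_zero hT).ge
  have hx1 : 0 < 1 - μ.real {x} :=
    sub_pos.2 (measureReal_le_one.lt_of_ne fun h => hx ((ENNReal.toReal_eq_one_iff _).1 h))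
  set q := (1 - μ.real {x}) / 2 with hq
  have hq1 : q ≤ 1 := by linarith [measureReal_nonneg (μ := μ) (s := {x})]
  refine ⟨(κ / 4) ^ 2 * q, by positivity, τ, hτ, ?_⟩
  filter_upwards [self_mem_nhdsWithin, hscale.eventually
    ((tendsto_measureReal_compl_closedBall μ x).eventually_const_le (half_lt_self hx1))]
    with h hh hcompl
  refine le_trans ?_ (sq_mul_min_le_variance_comp_smul_sub hK hM hκ
    (fun y hy => hnear (by simpa using hy)) (fun y hy => hfar hy) x hh)
  rw [mul_assoc]
  gcongr
  exact le_min (mul_le_of_le_one_left measureReal_nonneg hq1)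
    ((mul_le_of_le_one_right (by positivity) measureReal_le_one).trans hcompl)

end Variance

theorem exists_mul_rpow_le_measureReal_ball {X : Type*} [PseudoMetricSpace X] [MeasurableSpace X]
    {μ : Measure X} [IsFiniteMeasure μ] {x : X} {ν : ℝ}
    (h : 0 < liminf (fun r => μ (Metric.ball x r) / ENNReal.ofReal (r ^ ν)) (𝓝[>] 0)) :
    ∃ c > 0, ∀ᶠ r in 𝓝[>] 0, c * r ^ ν ≤ μ.real (Metric.ball x r) := by
  obtain ⟨c, hc, hclim⟩ := ENNReal.lt_iff_exists_nnreal_btwn.1 h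
  refine ⟨c, by exact_mod_cast hc, ?_⟩
  filter_upwards [eventually_lt_of_lt_liminf hclim] with r hr
  rw [Measure.real, ← ENNReal.ofReal_le_iff_le_toReal (measure_ne_top _ _),
    ENNReal.ofReal_mul c.coe_nonneg, ENNReal.ofReal_coe_nnreal]
  exact ENNReal.mul_le_of_le_div hr.le

namespace KernelDensity

open ProbabilityTheory

variable {d : ℕ} {𝕏 : Set (EuclideanSpace ℝ (Fin d))} {P : Measure (EuclideanSpace ℝ (Fin d))}
  {K : EuclideanSpace ℝ (Fin d) → ℝ} {M : ℝ}

theorem PositiveNearOrigin.exists_eventually_le (hK : PositiveNearOrigin K)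
    (hM : ∀ x, |K x| ≤ M) : ∃ κ > 0, ∀ᶠ x in 𝓝 0, κ ≤ K x := by
  obtain ⟨L, hL, hlim⟩ := hK
  obtain ⟨τ, hτ, hτ0⟩ :=
    ((hlim.eventually_const_le (half_lt_self hL)).and self_mem_nhdsWithin).exists
  refine ⟨L / 2, half_pos hL, ?_⟩
  filter_upwards [Metric.closedBall_mem_nhds 0 hτ0] with x hx
  have hbdd : BddBelow (Set.range fun x : Metric.closedBall (0 : EuclideanSpace ℝ (Fin d)) τ =>
      K x) := ⟨-M, Set.forall_mem_range.2 fun y => neg_le_of_abs_le (hM y)⟩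
  exact hτ.trans (ciInf_le hbdd ⟨x, hx⟩)

theorem KernelIntegrable.tendsto_cobounded (hdim : 0 < volDim 𝕏 P)
    (hK : KernelIntegrable 𝕏 P K 1) : Tendsto K (Bornology.cobounded _) (𝓝 0) := by
  refine (hasBasis_cobounded_norm.tendsto_iff Metric.nhds_basis_ball).2 fun κ hκ => ?_
  by_contra! hfar
  refine not_integrableOn_Ioi_rpow (volDim 𝕏 P - 1) ⟨by fun_prop, ?_⟩
  have hle : ENNReal.ofReal κ *
      ∫⁻ t in Set.Ioi (0 : ℝ), ENNReal.ofReal (t ^ (volDim 𝕏 P - 1)) < ⊤ := by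
    refine lt_of_le_of_lt ?_ (hK.2.resolve_left hdim.ne')
    rw [← lintegral_const_mul _ (by fun_prop)]
    refine lintegral_mono fun t => ?_
    obtain ⟨x, hx, hKx⟩ := hfar t trivial
    rw [mul_comm]
    gcongr
    refine le_iSup₂_of_le x hx ?_
    rw [Real.rpow_one]
    exact ENNReal.ofReal_le_ofReal (by simpa using hKx)
  refine lt_of_eq_of_lt (setLIntegral_congr_fun measurableSet_Ioi fun t ht => ?_)
    (ENNReal.lt_top_of_mul_ne_top_right hle.ne (by simpa using hκ))
  exact Real.enorm_of_nonneg (Real.rpow_nonneg (le_of_lt ht) _)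

theorem exists_pos_upperBallRate_lt_top (hdim : 0 < volDim 𝕏 P) :
    ∃ ν > 0, upperBallRate 𝕏 P ν < ⊤ := by
  have hne : {ν : ℝ | 0 ≤ ν ∧ upperBallRate 𝕏 P ν < ⊤}.Nonempty := by
    by_contra hempty
    rw [volDim, Set.not_nonempty_iff_eq_empty.1 hempty, Real.sSup_empty] at hdim
    exact lt_irrefl _ hdim
  obtain ⟨ν, ⟨-, hν⟩, hν0⟩ := exists_lt_of_lt_csSup hne hdim
  exact ⟨ν, hν0, hν⟩

theorem measure_singleton_eq_zero_of_upperBallRate_lt_top {ν : ℝ} (hν : 0 < ν)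
    (hrate : upperBallRate 𝕏 P ν < ⊤) {x : EuclideanSpace ℝ (Fin d)} (hx : x ∈ 𝕏) :
    P {x} = 0 := by
  obtain ⟨b, hb, hb'⟩ := exists_between hrate
  have htend : Tendsto (fun r : ℝ => b * ENNReal.ofReal (r ^ ν)) (𝓝[>] 0) (𝓝 0) := by
    have hrpow : Tendsto (fun r : ℝ => r ^ ν) (𝓝[>] 0) (𝓝 0) := by
      simpa only [Real.zero_rpow hν.ne'] using
        (Real.continuousAt_rpow_const 0 ν (.inr hν.le)).tendsto.mono_left nhdsWithin_le_nhds
    simpa only [ENNReal.ofReal_zero, mul_zero] using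
      ENNReal.Tendsto.const_mul (ENNReal.tendsto_ofReal hrpow) (.inr hb'.ne)
  refine le_antisymm (ge_of_tendsto htend ?_) zero_le
  filter_upwards [eventually_lt_of_limsup_lt hb, self_mem_nhdsWithin] with r hr hr0
  calc P {x} ≤ P (Metric.ball x r) :=
        measure_mono (Set.singleton_subset_iff.2 (Metric.mem_ball_self hr0))
    _ ≤ b * ENNReal.ofReal (r ^ ν) := by
        rw [← ENNReal.div_le_iff (ENNReal.ofReal_pos.2 (Real.rpow_pos_of_pos hr0 ν)).ne'
          ENNReal.ofReal_ne_top]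
        exact (le_iSup₂ (f := fun x (_ : x ∈ 𝕏) =>
          P (Metric.ball x r) / ENNReal.ofReal (r ^ ν)) x hx).trans hr.le

theorem eventually_mul_rpow_le_variance [IsProbabilityMeasure P] {ν : ℝ}
    {x : EuclideanSpace ℝ (Fin d)}
    (hP : 0 < liminf (fun r => P (Metric.ball x r) / ENNReal.ofReal (r ^ ν)) (𝓝[>] 0))
    (hx : P {x} ≠ 1) (hK : Measurable K) (hM : ∀ x, |K x| ≤ M)
    (hfar : Tendsto K (Bornology.cobounded _) (𝓝 0)) (hpos : PositiveNearOrigin K) :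
    ∃ c > 0, ∀ᶠ h in 𝓝[>] 0, c * h ^ ν ≤ Var[fun y => K (h⁻¹ • (x - y)); P] := by
  obtain ⟨κ, hκ, hnear⟩ := hpos.exists_eventually_le hM
  obtain ⟨a, ha, hball⟩ := exists_mul_rpow_le_measureReal_ball hP
  obtain ⟨c, hc, τ, hτ, hvar⟩ :=
    eventually_mul_measureReal_ball_le_variance hK hM hκ hnear hfar hx
  refine ⟨c * (a * τ ^ ν), by positivity, ?_⟩
  have hscale : Tendsto (τ * ·) (𝓝[>] 0) (𝓝[>] 0) :=
    tendsto_iff_comap.2 (comap_mulLeft_nhdsGT_zero hτ).ge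
  filter_upwards [hvar, hscale.eventually hball, self_mem_nhdsWithin] with h hvar hball hh
  calc c * (a * τ ^ ν) * h ^ ν = c * (a * (τ * h) ^ ν) := by
        rw [Real.mul_rpow hτ.le (le_of_lt hh)]
        ring
    _ ≤ c * P.real (Metric.ball x (τ * h)) := by gcongr
    _ ≤ _ := hvar

section Normalization

variable {n : ℕ} {h : ℝ}

instance [IsProbabilityMeasure P] : IsProbabilityMeasure (sampleLaw P n) :=
  inferInstanceAs (IsProbabilityMeasure (Measure.pi fun _ => P))

theorem measurableSet_abs_kde_sub_le (hK : Measurable K) (h : ℝ) (x : EuclideanSpace ℝ (Fin d))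
    (b ε : ℝ) :
    MeasurableSet {X : Fin n → EuclideanSpace ℝ (Fin d) | |kde K h X x - b| ≤ ε} := by
  unfold kde
  exact measurableSet_le (by fun_prop) measurable_const

theorem abs_kde_sub_le_iff (hn : n ≠ 0) (hh : 0 < h) (X : Fin n → EuclideanSpace ℝ (Fin d))
    (x : EuclideanSpace ℝ (Fin d)) (b ε : ℝ) :
    |kde K h X x - b| ≤ ε ↔
      |∑ i, K (h⁻¹ • (x - X i)) - n * h ^ d * b| ≤ n * h ^ d * ε := by
  have hpos : 0 < n * h ^ d := by positivity
  rw [← div_le_iff₀' hpos, ← abs_of_pos hpos, ← abs_div, abs_of_pos hpos, sub_div,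
    mul_div_cancel_left₀ _ hpos.ne', kde, one_div_mul_eq_div]

theorem mul_sqrt_one_div_mul_rpow (hn : n ≠ 0) (hh : 0 < h) (ν : ℝ) :
    n * h ^ d * √(1 / (n * h ^ (2 * (d : ℝ) - ν))) = √(n * h ^ ν) := by
  have hnd : 0 ≤ n * h ^ d := by positivity
  rw [Real.rpow_sub hh, mul_comm 2 (d : ℝ), Real.rpow_mul hh.le, Real.rpow_natCast, Real.rpow_ofNat]
  nth_rw 1 [← Real.sqrt_sq hnd]
  rw [← Real.sqrt_mul (sq_nonneg _)]
  congr 1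
  field_simp

theorem sampleLaw_real_abs_kde_sub_le_le [IsProbabilityMeasure P] (hK : Measurable K)
    (hM : ∀ x, |K x| ≤ M) (hn : n ≠ 0) (hh : 0 < h) {x : EuclideanSpace ℝ (Fin d)} {c ν C : ℝ}
    (hc : 0 < c) (hvar : c * h ^ ν ≤ Var[fun y => K (h⁻¹ • (x - y)); P]) (hC : 0 < C)
    (hMC : (M / C) ^ 2 ≤ n * h ^ ν) (b : ℝ) :
    (sampleLaw P n).real
        {X | |kde K h X x - b| ≤ C * √(1 / (n * h ^ (2 * (d : ℝ) - ν)))} ≤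
      C * (4 * √(Real.pi ^ 3 / (2 * c))) := by
  have : Nonempty (Fin n) := Fin.pos_iff_nonempty.1 (Nat.pos_of_ne_zero hn)
  have hM_le : M ≤ C * √(n * h ^ ν) := by
    rw [← div_le_iff₀' hC]
    exact Real.le_sqrt_of_sq_le hMC
  simp_rw [abs_kde_sub_le_iff hn hh, mul_left_comm _ C, mul_sqrt_one_div_mul_rpow hn hh]
  have hKx : Measurable fun y => K (h⁻¹ • (x - y)) := by fun_prop
  have hanti := measureReal_pi_abs_sum_sub_le_le (ι := Fin n) (P := P) hKx.aemeasurable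
    (ae_of_all _ fun y => hM _) (by positivity) hM_le
    ((by positivity : 0 < c * h ^ ν).trans_le hvar) (n * h ^ d * b)
  calc _ ≤ _ := hanti
    _ ≤ 4 * √(Real.pi ^ 3 / 2 * ((C * √(n * h ^ ν)) ^ 2 / (n * (c * h ^ ν)))) := by
        rw [Fintype.card_fin]
        gcongr
    _ = 4 * √(C ^ 2 * (Real.pi ^ 3 / (2 * c))) := by
        rw [mul_pow, Real.sq_sqrt (by positivity)]
        field_simp
    _ = C * (4 * √(Real.pi ^ 3 / (2 * c))) := by
        rw [Real.sqrt_mul (sq_nonneg C), Real.sqrt_sq hC.le, mul_left_comm]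

end Normalization

end KernelDensity

theorem mainTheorem4_general {d : ℕ} (𝕏 : Set (EuclideanSpace ℝ (Fin d)))
    (P : Measure (EuclideanSpace ℝ (Fin d))) [IsProbabilityMeasure P] (ν : ℝ)
    (hP : 0 < ⨆ x ∈ 𝕏, liminf
      (fun r : ℝ => P (Metric.ball x r) / ENNReal.ofReal (r ^ ν)) (𝓝[>] 0))
    (hP₁ : ∀ x ∈ 𝕏, P {x} ≠ 1)
    (K : EuclideanSpace ℝ (Fin d) → ℝ) (hKmeas : Measurable K) (hKbdd : ∃ M, ∀ x, |K x| ≤ M)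
    (hKfar : Tendsto K (Bornology.cobounded _) (𝓝 0)) (hKpos : KernelDensity.PositiveNearOrigin K) :
    ∃ h₀ : ℝ, 0 < h₀ ∧ ∀ δ : ℝ, 0 < δ →
      ∃ C : ℝ, 0 < C ∧ ∀ h : ℕ → ℝ, (∀ n, 0 < h n) →
        Tendsto (fun n : ℕ => (n : ℝ) * h n ^ ν) atTop atTop →
        ∃ N : ℕ, ∀ n : ℕ, N ≤ n → h n ≤ h₀ →
          ∃ A : Set (Fin n → EuclideanSpace ℝ (Fin d)), MeasurableSet A ∧
            ENNReal.ofReal (1 - δ) ≤ KernelDensity.sampleLaw P n A ∧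
            ∀ X ∈ A,
              ENNReal.ofReal (C * √(1 / ((n : ℝ) * h n ^ (2 * (d : ℝ) - ν)))) ≤
                KernelDensity.supDeviation 𝕏 P K (h n) X := by
  obtain ⟨M, hM⟩ := hKbdd
  obtain ⟨x, hx, hPx⟩ := lt_biSup_iff.1 hP
  obtain ⟨c, hc, hvar⟩ :=
    KernelDensity.eventually_mul_rpow_le_variance hPx (hP₁ x hx) hKmeas hM hKfar hKpos
  obtain ⟨h₀, hh₀, hvar⟩ := mem_nhdsGT_iff_exists_Ioc_subset.1 hvar
  refine ⟨h₀, hh₀, fun δ hδ => ?_⟩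
  set a := 4 * √(Real.pi ^ 3 / (2 * c))
  have ha : 0 < a := by positivity
  have hC : 0 < δ / a := by positivity
  refine ⟨δ / a, hC, fun h hh hlim => ?_⟩
  obtain ⟨N, hN⟩ := eventually_atTop.1 ((hlim.eventually_ge_atTop ((M / (δ / a)) ^ 2)).and
    (eventually_ne_atTop 0))
  refine ⟨N, fun n hn hle => ?_⟩
  obtain ⟨hMn, hn0⟩ := hN n hn
  have hprob := KernelDensity.sampleLaw_real_abs_kde_sub_le_le hKmeas hM hn0 (hh n) hc
    (hvar ⟨hh n, hle⟩) hC hMn (KernelDensity.kdeMean P K n (h n) x)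
  rw [div_mul_cancel₀ δ ha.ne'] at hprob
  have hmeas := KernelDensity.measurableSet_abs_kde_sub_le (n := n) hKmeas (h n) x
    (KernelDensity.kdeMean P K n (h n) x) (δ / a * √(1 / (n * h n ^ (2 * (d : ℝ) - ν))))
  refine ⟨_, hmeas.compl, ?_, fun X hX => ?_⟩
  · rw [← ofReal_measureReal, probReal_compl_eq_one_sub hmeas]
    gcongr
  · rw [Set.mem_compl_iff, Set.mem_ofPred_eq, not_le] at hX
    exact le_iSup₂_of_le x hx (ENNReal.ofReal_le_ofReal hX.le)

theorem mainTheorem4 {d : ℕ} (𝕏 : Set (EuclideanSpace ℝ (Fin d)))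
    (P : Measure (EuclideanSpace ℝ (Fin d))) [IsProbabilityMeasure P]
    (hP : KernelDensity.ExactLower 𝕏 P) (hdim : 0 < KernelDensity.volDim 𝕏 P)
    (K : EuclideanSpace ℝ (Fin d) → ℝ) (hKmeas : Measurable K)
    (hKint : KernelDensity.KernelIntegrable 𝕏 P K 1)
    (hKpos : KernelDensity.PositiveNearOrigin K) :
    ∃ h₀ : ℝ, 0 < h₀ ∧ ∀ δ : ℝ, 0 < δ → δ < 1 →
      ∃ C : ℝ, 0 < C ∧ ∀ h : ℕ → ℝ, (∀ n, 0 < h n) →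
        Tendsto (fun n : ℕ => (n : ℝ) * h n ^ KernelDensity.volDim 𝕏 P) atTop atTop →
        ∃ N : ℕ, ∀ n : ℕ, N ≤ n → h n ≤ h₀ →
          ∃ A : Set (Fin n → EuclideanSpace ℝ (Fin d)), MeasurableSet A ∧
            ENNReal.ofReal (1 - δ) ≤ KernelDensity.sampleLaw P n A ∧
            ∀ X ∈ A,
              ENNReal.ofReal (C * √(1 / ((n : ℝ) *
                  h n ^ (2 * (d : ℝ) - KernelDensity.volDim 𝕏 P)))) ≤
                KernelDensity.supDeviation 𝕏 P K (h n) X := by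
  obtain ⟨ν, hν, hrate⟩ := KernelDensity.exists_pos_upperBallRate_lt_top hdim
  have hatom (x) (hx : x ∈ 𝕏) : P {x} ≠ 1 := by
    simp [KernelDensity.measure_singleton_eq_zero_of_upperBallRate_lt_top hν hrate hx]
  obtain ⟨h₀, hh₀, H⟩ := mainTheorem4_general 𝕏 P _ hP hatom K hKmeas hKint.1
    (hKint.tendsto_cobounded hdim) hKpos
  exact ⟨h₀, hh₀, fun δ hδ _ => H δ hδ⟩
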